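/- Let $\mathbb H$ be the quaternions, $K\le\mathbb H^\times$ a finite group, and $H\trianglelefteq K$ a normal subgroup with $[K,K]\le H$ and $H\ne\{1\}$. For $n\ge 1$ let $G_n(K,H)\le \mathrm{GL}_n(\mathbb H)$ be the group of all matrices $\mathrm{diag}(\theta_1,\dots,\theta_n)M(\sigma)$, where $\theta_1,\dots,\theta_n\in K$, $\theta_1\cdots\theta_n\in H$, and $M(\sigma)$ is the permutation matrix of $\sigma\in S_n$; it acts from the left on the right $\mathbb H$-vector space $\mathbb H^n$ with standard basis $e_1,\dots,e_n$. A parabolic subgroup of $G_n(K,H)$ is the pointwise stabilizer in $G_n(K,H)$ of a subset of $\mathbb H^n$. For $0\le m\le n$, a partition $\lambda=(\lambda_1\ge\dots\ge\lambda_k)\vdash m$ and $\alpha\in K$, let $I_1,\dots,I_k$ be the consecutive intervals of lengths $\lambda_1,\dots,\lambda_k$ in $\{1,\dots,m\}$, let $I_0=\{m+1,\dots,n\}$, and let $\xi(1)=\alpha$, $\xi(j)=1$ for $j\ge2$. Put $P_\lambda^\alpha:=P_0\times P_1\times\cdots\times P_k$, where $P_0\cong G_{n-m}(K,H)$ acts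 on the span of the $e_j$, $j\in I_0$ (and fixes the other $e_j$), and $P_i\cong S_{\lambda_i}$ permutes the vectors $\xi(j)e_j$, $j\in I_i$ (and fixes the other basis vectors). Write $P_\lambda:=P_\lambda^1$. **Theorem.** A system of representatives (each class being represented exactly once) of the $G_n(K,H)$-conjugacy classes of parabolic subgroups of $G_n(K,H)$ is given as follows. (a) If $K/H$ is cyclic and $\alpha\in K$ is any element whose class generates $K/H$: (i) $P_\lambda$ with $\lambda\vdash m$ and $0\le m<n$; (ii) $P_\lambda^{\alpha^s}$ with $\lambda=(\lambda_1,\dots,\lambda_k)\vdash n$ and $0\le s<\gcd([K:H],\lambda_1,\dots,\lambda_k)$. (b) If $K=\mathsf D_{2d}$ is the binary dihedral group of order $8d$ and $H=\mathsf C_{2d}$ is cyclic of order $2d$, for some $d\ge1$ (as isomorphism types), and $\{1,\alpha,\beta,\gamma\}\subseteq K$ is any system of representatives of the cosets of $H$ in $K$: (i) $P_\lambda$ with $\lambda\vdash m$ and $0\le m<n$; (ii) $P_\lambda$ with $\lambda=(\lambda_1,\dots,\lambda_k)\vdash n$ and $2\nmid\gcd(\lambda_1,\dots,\lambda_k)$;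 (iii) $P_\lambda^1, P_\lambda^\alpha, P_\lambda^\beta, P_\lambda^\gamma$ with $\lambda=(\lambda_1,\dots,\lambda_k)\vdash n$ and $2\mid\gcd(\lambda_1,\dots,\lambda_k)$. -/

import Mathlib

open scoped Quaternion

namespace QuatRefl

/-- The group `GL_n(ℍ)` of invertible quaternionic `n × n` matrices. It acts from the left, by
`Matrix.mulVec`, on the right vector space `ℍⁿ = (Fin n → ℍ)` of column vectors. -/
abbrev GLH (n : ℕ) : Type := (Matrix (Fin n) (Fin n) ℍ[ℝ])ˣ

/-- The monomial matrix `diag(θ) M(σ)`: the `j`-th column has its only nonzero entry, `θ (σ j)`,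
in row `σ j`; so `e_j` is mapped to `e_{σ j}` with coefficient `θ (σ j)`. -/
noncomputable def monomial {n : ℕ} (θ : Fin n → ℍ[ℝ]ˣ) (σ : Equiv.Perm (Fin n)) : GLH n where
  val := Matrix.of fun i j => if i = σ j then (θ i : ℍ[ℝ]) else 0
  inv := Matrix.of fun i j => if σ i = j then (((θ j)⁻¹ : ℍ[ℝ]ˣ) : ℍ[ℝ]) else 0
  val_inv := by
    ext1 i k
    rw [Matrix.mul_apply, Finset.sum_eq_single (σ.symm i)]
    · by_cases h : i = k
      · subst h; simp
      · simp [h]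
    · intro b _ hb
      have : i ≠ σ b := fun h => hb (by simp [h])
      simp [this]
    · simp
  inv_val := by
    ext1 i k
    rw [Matrix.mul_apply, Finset.sum_eq_single (σ i)]
    · by_cases h : i = k
      · subst h; simp
      · simp [h]
    · intro b _ hb
      simp [Ne.symm hb]
    · simp

theorem monomial_one {n : ℕ} : monomial (n := n) 1 1 = 1 := by
  ext1
  ext1 i j
  by_cases h : i = j <;> simp [monomial, h]

theorem monomial_mul {n : ℕ} (θ θ' : Fin n → ℍ[ℝ]ˣ) (σ σ' : Equiv.Perm (Fin n)) :
    monomial θ σ * monomial θ' σ' = monomial (fun i => θ i * θ' (σ⁻¹ i)) (σ * σ') := by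
  ext1
  ext1 i k
  simp only [monomial, Units.val_mul, Matrix.mul_apply, Matrix.of_apply]
  rw [Finset.sum_eq_single (σ⁻¹ i)]
  · by_cases h : i = σ (σ' k)
    · subst h; simp
    · have h' : ¬ σ⁻¹ i = σ' k := fun e => h (by rw [← e]; simp)
      have h2 : ¬ i = (σ * σ') k := h
      rw [if_neg h', if_neg h2, mul_zero]
  · intro b _ hb
    have : i ≠ σ b := fun h => hb (by simp [h])
    simp [this]
  · simp

theorem monomial_inv {n : ℕ} (θ : Fin n → ℍ[ℝ]ˣ) (σ : Equiv.Perm (Fin n)) :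
    (monomial θ σ)⁻¹ = monomial (fun i => (θ (σ i))⁻¹) σ⁻¹ := by
  rw [inv_eq_iff_mul_eq_one, monomial_mul, ← monomial_one]
  congr 1
  · funext i; simp
  · simp

theorem prod_mem_iff {K : Subgroup ℍ[ℝ]ˣ} {H : Subgroup K} (hKH : commutator K ≤ H) {n : ℕ}
    (θ : Fin n → K) :
    (List.ofFn θ).prod ∈ H ↔ ∏ i, Abelianization.of (θ i) ∈ H.map Abelianization.of := by
  have hker : (Abelianization.of (G := K)).ker ≤ H := by
    rw [Abelianization.ker_of]; exact hKH
  have h1 : ∏ i, Abelianization.of (θ i) = Abelianization.of (List.ofFn θ).prod := by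
    rw [map_list_prod, List.map_ofFn, List.prod_ofFn]; rfl
  rw [h1]
  constructor
  · exact fun h => Subgroup.mem_map_of_mem _ h
  · intro h
    have h2 : (List.ofFn θ).prod ∈ (H.map Abelianization.of).comap Abelianization.of := h
    rwa [Subgroup.comap_map_eq_self hker] at h2

/-- For finite groups `[K, K] ≤ H ⊴ K ≤ ℍˣ` and a set `S` of `m` coordinates, the copy of the group
`G_m(K, H)` that acts on the span of the `e_i` with `i ∈ S` and fixes the other `e_i`: all
`diag(θ) M(σ)` with `θ` and `σ` supported on `S`, all `θ i ∈ K`, and the product of the `θ i`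
(in increasing order of `i`) in `H`. -/
noncomputable def reflGroupOn {n : ℕ} (K : Subgroup ℍ[ℝ]ˣ) (H : Subgroup K) (hKH : commutator K ≤ H)
    (S : Finset (Fin n)) : Subgroup (GLH n) where
  carrier := {g | ∃ (θ : Fin n → K) (σ : Equiv.Perm (Fin n)),
    (∀ i ∉ S, θ i = 1 ∧ σ i = i) ∧ (List.ofFn θ).prod ∈ H ∧
      g = monomial (fun i => (θ i : ℍ[ℝ]ˣ)) σ}
  one_mem' := by
    refine ⟨1, 1, by simp, ?_, ?_⟩
    · rw [prod_mem_iff hKH]; simp [one_mem]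
    · exact monomial_one.symm
  mul_mem' := by
    rintro _ _ ⟨θ, σ, hs, hp, rfl⟩ ⟨θ', σ', hs', hp', rfl⟩
    refine ⟨fun i => θ i * θ' (σ⁻¹ i), σ * σ', ?_, ?_, ?_⟩
    · intro i hi
      have h1 : σ⁻¹ i = i := by rw [Equiv.Perm.inv_eq_iff_eq]; exact (hs i hi).2.symm
      simp [h1, hs i hi, hs' i hi]
    · rw [prod_mem_iff hKH] at hp hp' ⊢
      simp only [map_mul, Finset.prod_mul_distrib]
      rw [Equiv.prod_comp σ⁻¹ (fun i => Abelianization.of (θ' i))]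
      exact mul_mem hp hp'
    · rw [monomial_mul]; rfl
  inv_mem' := by
    rintro _ ⟨θ, σ, hs, hp, rfl⟩
    refine ⟨fun i => (θ (σ i))⁻¹, σ⁻¹, ?_, ?_, ?_⟩
    · intro i hi
      have h1 : σ⁻¹ i = i := by rw [Equiv.Perm.inv_eq_iff_eq]; exact (hs i hi).2.symm
      simp [h1, hs i hi]
    · rw [prod_mem_iff hKH] at hp ⊢
      simp only [map_inv, Finset.prod_inv_distrib]
      rw [Equiv.prod_comp σ (fun i => Abelianization.of (θ i))]
      exact inv_mem hp
    · rw [monomial_inv]; rfl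

/-- The group `G_n(K, H) = A_n(K, H) ⋊ S_n ≤ GL_n(ℍ)`: all matrices `diag(θ) M(σ)` with `θ i ∈ K`
and `θ 1 ⋯ θ n ∈ H`. -/
noncomputable def reflGroup (n : ℕ) (K : Subgroup ℍ[ℝ]ˣ) (H : Subgroup K) (hKH : commutator K ≤ H) :
    Subgroup (GLH n) :=
  reflGroupOn K H hKH Finset.univ

/-- `σ ↦ M(σ)`, the permutation matrices, `M(σ) e_j = e_{σ j}`. -/
noncomputable def permHom (n : ℕ) : Equiv.Perm (Fin n) →* GLH n where
  toFun σ := monomial 1 σ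
  map_one' := monomial_one
  map_mul' σ σ' := by rw [monomial_mul]; congr 1; funext i; simp

/-- The symmetric group on `S` permuting the vectors `ξ(j) e_j`, `j ∈ S`, and fixing the `e_i` with
`i ∉ S`: all `diag(ξ) M(σ) diag(ξ)⁻¹` where `σ` fixes the complement of `S`. It depends
only on the values of `ξ` on `S`. -/
noncomputable def symmGroupOn {n : ℕ} (S : Finset (Fin n)) (ξ : Fin n → ℍ[ℝ]ˣ) : Subgroup (GLH n) :=
  ((fixingSubgroup (Equiv.Perm (Fin n)) ((S : Set (Fin n))ᶜ)).map (permHom n)).map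
    (MulAut.conj (monomial ξ 1)).toMonoidHom

/-- `P_{(I₀, Π, ξ)} = P₀ × P₁ × ⋯ × P_d` for a partition `Π = (I_1, …, I_d)` of the complement of
`I₀`: the internal product of `P₀ = G_{|I₀|}(K, H)` on the coordinates in `I₀` and of the symmetric
groups permuting the `ξ(j) e_j`, `j ∈ I_i`. The values of `ξ` on `I₀` are irrelevant. -/
noncomputable def tripleGroup {n : ℕ} (K : Subgroup ℍ[ℝ]ˣ) (H : Subgroup K) (hKH : commutator K ≤ H)
    (I₀ : Finset (Fin n)) {d : ℕ} (I : Fin d → Finset (Fin n)) (ξ : Fin n → K) :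
    Subgroup (GLH n) :=
  reflGroupOn K H hKH I₀ ⊔ ⨆ i, symmGroupOn (I i) (fun j => (ξ j : ℍ[ℝ]ˣ))

/-- The parts `λ_1 ≥ λ_2 ≥ ⋯ ≥ λ_k` of a partition in decreasing order. -/
def sortedParts {m : ℕ} (lam : m.Partition) : List ℕ := lam.parts.sort (· ≥ ·)

/-- The `i`-th block of coordinates (everything counted from `0`),
`λ_0 + ⋯ + λ_{i-1} ≤ j < λ_0 + ⋯ + λ_i`. -/
def block (n : ℕ) {m : ℕ} (lam : m.Partition) (i : ℕ) : Finset (Fin n) :=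
  {j | ((sortedParts lam).take i).sum ≤ (j : ℕ) ∧ (j : ℕ) < ((sortedParts lam).take (i + 1)).sum}

/-- `P_λ^α` for a partition `λ` of `m ≤ n` and `α ∈ K`: here `I₀` consists of the last `n - m`
coordinates, the blocks are the consecutive intervals of lengths `λ_1, …, λ_k`, and
`ξ` is `α` at the first coordinate and `1` elsewhere. -/
noncomputable def partitionGroup (n : ℕ) (K : Subgroup ℍ[ℝ]ˣ) (H : Subgroup K) (hKH : commutator K ≤ H)
    {m : ℕ} (lam : m.Partition) (α : K) : Subgroup (GLH n) :=
  tripleGroup K H hKH {j : Fin n | m ≤ (j : ℕ)}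
    (fun i : Fin (sortedParts lam).length => block n lam i)
    (fun j => if (j : ℕ) = 0 then α else 1)

/-- `P` is a parabolic subgroup of `G`: the pointwise stabilizer in `G` of a subset of `ℍⁿ`. -/
def IsParabolic {n : ℕ} (G P : Subgroup (GLH n)) : Prop :=
  ∃ U : Set (Fin n → ℍ[ℝ]), ∀ g : GLH n,
    g ∈ P ↔ g ∈ G ∧ ∀ v ∈ U, (g : Matrix (Fin n) (Fin n) ℍ[ℝ]).mulVec v = v

/-- `P` and `Q` are conjugate by an element of `G`. -/
def IsConjIn {n : ℕ} (G P Q : Subgroup (GLH n)) : Prop :=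
  ∃ g ∈ G, P.map (MulAut.conj g).toMonoidHom = Q

/-- The family `R` is a system of representatives, without repetitions, of the `G`-conjugacy classes
of parabolic subgroups of `G`. -/
def IsParabolicRepresentatives {n : ℕ} (G : Subgroup (GLH n)) {ι : Type}
    (R : ι → Subgroup (GLH n)) : Prop :=
  (∀ i, IsParabolic G (R i)) ∧ ∀ P, IsParabolic G P → ∃! i, IsConjIn G (R i) P

end QuatRefl

/-!
A parabolic subgroup `P`, the pointwise stabilizer of `U ⊆ ℍⁿ`, is described by a colouring of the
coordinates together with scalars `ξ(j) ∈ K`. Call two coordinates equivalent if the rows of `U`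
they index differ by a factor from `K` on the left; coordinates with zero row form `I₀` and stay
uncoloured. As `K` acts freely on nonzero rows, the stabilizer consists of the `diag(θ) M(σ)` in
`G_n(K, H)` for which `σ` preserves the colours and `θ` is determined by `σ` and `ξ` outside `I₀`
(`IsParabolic.exists_colorStab`). Generating the colour-preserving permutations by transpositions
identifies these groups with the products `P₀ × P₁ × ⋯` (`coe_tripleGroup`), and all of them are
parabolic, since elements of `K` have norm one and one vector with blocks of different norms
separates the colours (`isParabolic_of_eq_colorStab`).

Conjugation by `diag(θ) M(τ)` moves the colour classes by `τ` and multiplies `ξ` by `θ`, while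
multiplying `ξ` from the right by a constant on each class does not change the group. Because
`H ≠ 1`, the group determines `I₀`, the colour classes and `ξ` up to such constants, so this
describes conjugacy completely (`isConjIn_of_colorIso`, `IsConjIn.exists_colorIso`). If `I₀` is not
empty, only the sizes of the classes remain as an invariant (`isConjIn_of_shape_eq`). If `I₀` is
empty, there is also the class of `∏ ξ(j)` in the abelian group `K / H`; the constants on the
classes change it by an arbitrary product of `λ_i`-th powers, which by Bézout means by an arbitrary
`gcd(λ)`-th power (`isConjIn_iff`). So representatives are obtained from representatives of `K / H`
modulo `gcd(λ)`-th powers (`isParabolicRepresentatives_of_existsUnique`). For `K / H` cyclic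
these are powers of a generator. For binary dihedral `K` of order `8 d` all squares are
commutators, hence `K / H` has exponent two, and the `g`-th powers are trivial or everything according to the parity of `g`.
-/

open scoped Quaternion

namespace QuatRefl

variable {n : ℕ} {K : Subgroup ℍ[ℝ]ˣ} {H : Subgroup K} {A : Type*} [CommGroup A] {f : K →* A}

/-! ### Monomial matrices -/

theorem monomial_injective {θ θ' : Fin n → ℍ[ℝ]ˣ} {σ σ' : Equiv.Perm (Fin n)}
    (h : monomial θ σ = monomial θ' σ') : θ = θ' ∧ σ = σ' := by
  have key : ∀ i j, (if i = σ j then (θ i : ℍ[ℝ]) else 0) = if i = σ' j then (θ' i : ℍ[ℝ]) else 0 :=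
    fun i j => congrFun (congrFun (congrArg (fun g : GLH n => (g : Matrix _ _ ℍ[ℝ])) h) i) j
  have hσ : σ = σ' := by
    ext1 j
    by_contra hne
    have := key (σ j) j
    rw [if_pos rfl, if_neg hne] at this
    exact (θ (σ j)).ne_zero this
  subst hσ
  refine ⟨?_, rfl⟩
  funext i
  have := key i (σ⁻¹ i)
  ext1
  simpa using this

theorem monomial_mulVec (θ : Fin n → ℍ[ℝ]ˣ) (σ : Equiv.Perm (Fin n)) (v : Fin n → ℍ[ℝ])
    (i : Fin n) :
    (monomial θ σ : Matrix (Fin n) (Fin n) ℍ[ℝ]).mulVec v (σ i) = θ (σ i) * v i := by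
  simp only [monomial, Matrix.mulVec, dotProduct, Matrix.of_apply]
  rw [Finset.sum_eq_single i]
  · simp
  · intro b _ hb
    simp [Ne.symm hb]
  · simp

theorem monomial_mulVec_eq_iff (θ : Fin n → ℍ[ℝ]ˣ) (σ : Equiv.Perm (Fin n)) (v : Fin n → ℍ[ℝ]) :
    (monomial θ σ : Matrix (Fin n) (Fin n) ℍ[ℝ]).mulVec v = v ↔
      ∀ i, (θ (σ i) : ℍ[ℝ]) * v i = v (σ i) := by
  constructor
  · intro h i
    rw [← monomial_mulVec, h]
  · intro h
    funext i
    obtain ⟨j, rfl⟩ := σ.surjective i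
    rw [monomial_mulVec, h]

theorem monomial_conj (θ φ : Fin n → ℍ[ℝ]ˣ) (τ σ : Equiv.Perm (Fin n)) :
    monomial θ τ * monomial φ σ * (monomial θ τ)⁻¹ =
      monomial (fun i => θ i * φ (τ⁻¹ i) * (θ (τ (σ⁻¹ (τ⁻¹ i))))⁻¹) (τ * σ * τ⁻¹) := by
  rw [monomial_inv, monomial_mul, monomial_mul]
  congr 1

/-! ### Stabilizers described by colourings -/

/-- Membership in `H` is tested in a commutative quotient `A` of `K` with kernel `H`, where the
order of the factors does not matter. -/
theorem prod_mem_iff_of_ker (hf : f.ker = H)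
    (θ : Fin n → K) : (List.ofFn θ).prod ∈ H ↔ ∏ i, f (θ i) = 1 := by
  rw [← hf, MonoidHom.mem_ker, map_list_prod, List.map_ofFn, List.prod_ofFn]
  rfl

theorem mem_reflGroup_iff {hKH : commutator K ≤ H} {g : GLH n} :
    g ∈ reflGroup n K H hKH ↔ ∃ (θ : Fin n → K) (σ : Equiv.Perm (Fin n)),
      (List.ofFn θ).prod ∈ H ∧ g = monomial (fun i => (θ i : ℍ[ℝ]ˣ)) σ := by
  constructor
  · rintro ⟨θ, σ, -, h1, h2⟩
    exact ⟨θ, σ, h1, h2⟩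
  · rintro ⟨θ, σ, h1, h2⟩
    exact ⟨θ, σ, by simp, h1, h2⟩

/-- The elements of `G_n(K, H)` attached to a colouring `c` of the coordinates and a vector `ξ` of
scalars: the `diag(θ) M(σ)` for which `σ` preserves the colours and which permute the `ξ(j) e_j`,
for `j` with a colour `some a`. The colour `none` marks the coordinates of `I₀`, on which `θ` is
not constrained and the values of `ξ` do not matter. -/
def colorStab {ι : Type*} (H : Subgroup K) (c : Fin n → Option ι) (ξ : Fin n → K) :
    Set (GLH n) :=
  {g | ∃ (θ : Fin n → K) (σ : Equiv.Perm (Fin n)), (List.ofFn θ).prod ∈ H ∧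
    g = monomial (fun i => (θ i : ℍ[ℝ]ˣ)) σ ∧ (∀ i, c (σ i) = c i) ∧
    ∀ i, c i ≠ none → θ (σ i) * ξ i = ξ (σ i)}

theorem monomial_mem_colorStab_iff {ι : Type*} {c : Fin n → Option ι} {ξ : Fin n → K}
    {θ : Fin n → K} {σ : Equiv.Perm (Fin n)} :
    monomial (fun i => (θ i : ℍ[ℝ]ˣ)) σ ∈ colorStab H c ξ ↔ (List.ofFn θ).prod ∈ H ∧
      (∀ i, c (σ i) = c i) ∧ ∀ i, c i ≠ none → θ (σ i) * ξ i = ξ (σ i) := by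
  constructor
  · rintro ⟨θ', σ', h1, h2, h3⟩
    obtain ⟨hθ, rfl⟩ := monomial_injective h2
    have : θ = θ' := by
      funext i
      exact Subtype.ext (congrFun hθ i)
    subst this
    exact ⟨h1, h3⟩
  · rintro ⟨h1, h2⟩
    exact ⟨θ, σ, h1, rfl, h2⟩

theorem norm_eq_one_of_finite [Finite K] (x : K) : ‖((x : ℍ[ℝ]ˣ) : ℍ[ℝ])‖ = 1 := by
  have h : IsOfFinOrder x := isOfFinOrder_of_finite x
  exact (((Units.coeHom ℍ[ℝ]).comp K.subtype).isOfFinOrder h).norm_eq_one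

/-- Every parabolic subgroup is given by a colouring: for a set `U` of vectors, the coordinates on
which `U` vanishes get no colour, and two others get the same colour if and only if the
corresponding rows of `U` are left multiples of each other by an element of `K`. -/
theorem IsParabolic.exists_colorStab {hKH : commutator K ≤ H} {P : Subgroup (GLH n)}
    (hP : IsParabolic (reflGroup n K H hKH) P) :
    ∃ (c : Fin n → Option (Fin n)) (ξ : Fin n → K), (P : Set (GLH n)) = colorStab H c ξ := by
  classical
  obtain ⟨U, hU⟩ := hP
  -- the rows of `U` up to left multiplication by `K`
  let s : Setoid (Fin n) :=
    { r := fun i j => ∃ κ : K, ∀ u ∈ U, u i = (κ : ℍ[ℝ]ˣ) * u j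
      iseqv :=
        { refl := fun i => ⟨1, by simp⟩
          symm := by
            rintro i j ⟨κ, h⟩
            refine ⟨κ⁻¹, fun u hu => ?_⟩
            rw [h u hu]
            simp
          trans := by
            rintro i j k ⟨κ, h⟩ ⟨κ', h'⟩
            refine ⟨κ * κ', fun u hu => ?_⟩
            rw [h u hu, h' u hu]
            simp [mul_assoc] } }
  let rep : Fin n → Fin n := fun i => (Quotient.mk s i).out
  have hrep : ∀ i, ∃ κ : K, ∀ u ∈ U, u i = (κ : ℍ[ℝ]ˣ) * u (rep i) :=
    fun i => s.symm (Quotient.exact (Quotient.out_eq (Quotient.mk s i)))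
  choose ξ hξ using hrep
  have rep_eq : ∀ i j, s.r i j → rep i = rep j := fun i j h => by
    simp only [rep]
    rw [Quotient.sound h]
  let c : Fin n → Option (Fin n) := fun i => if ∀ u ∈ U, u i = 0 then none else some (rep i)
  refine ⟨c, ξ, ?_⟩
  ext g
  rw [SetLike.mem_coe, hU, mem_reflGroup_iff]
  constructor
  · rintro ⟨⟨θ, σ, h1, rfl⟩, h2⟩
    have h3 : ∀ i, ∀ u ∈ U, ((θ (σ i) : ℍ[ℝ]ˣ) : ℍ[ℝ]) * u i = u (σ i) := fun i u hu =>
      (monomial_mulVec_eq_iff _ _ _).1 (h2 u hu) i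
    have hr : ∀ i, rep (σ i) = rep i := fun i => rep_eq _ _ ⟨θ (σ i), fun u hu => (h3 i u hu).symm⟩
    have hz : ∀ i, (∀ u ∈ U, u (σ i) = 0) ↔ ∀ u ∈ U, u i = 0 := by
      intro i
      refine forall₂_congr fun u hu => ?_
      rw [← h3 i u hu]
      simp
    rw [monomial_mem_colorStab_iff]
    refine ⟨h1, fun i => by simp only [c, hz, hr], fun i hi => ?_⟩
    have hi' : ∃ u ∈ U, u i ≠ 0 := by
      by_contra! hcon
      exact hi (if_pos hcon)
    obtain ⟨u, hu, hui⟩ := hi'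
    have e1 := h3 i u hu
    rw [hξ i u hu, hξ (σ i) u hu, hr, ← mul_assoc] at e1
    have hne : u (rep i) ≠ 0 := by
      intro h0
      rw [hξ i u hu, h0, mul_zero] at hui
      exact hui rfl
    have e2 := mul_right_cancel₀ hne e1
    ext1
    ext1
    simpa using e2
  · rintro ⟨θ, σ, h1, rfl, h2, h3⟩
    refine ⟨⟨θ, σ, h1, rfl⟩, fun u hu => ?_⟩
    rw [monomial_mulVec_eq_iff]
    intro i
    by_cases hi : ∀ u ∈ U, u i = 0
    · have hc := h2 i
      simp only [c, if_pos hi] at hc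
      have hi' : ∀ u ∈ U, u (σ i) = 0 := by
        by_contra hcon
        rw [if_neg hcon] at hc
        cases hc
      rw [hi u hu, hi' u hu, mul_zero]
    · have hc := h2 i
      have hi0 : c i ≠ none := by simp [c, if_neg hi]
      simp only [c, if_neg hi] at hc
      have hr : rep (σ i) = rep i := by
        split_ifs at hc with h
        simpa using hc
      rw [hξ i u hu, hξ (σ i) u hu, hr, ← mul_assoc, ← h3 i hi0]
      simp

/-- A colouring with finitely many colours defines a parabolic subgroup: as `K` is finite, its
elements have norm one, so the stabilizer of the single vector with entries `ξ(j) (a + 1)`, for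
`j` of colour `a`, preserves the colours. -/
theorem isParabolic_of_eq_colorStab [Finite K] {hKH : commutator K ≤ H} {P : Subgroup (GLH n)}
    {d : ℕ} {c : Fin n → Option (Fin d)} {ξ : Fin n → K}
    (hP : (P : Set (GLH n)) = colorStab H c ξ) : IsParabolic (reflGroup n K H hKH) P := by
  let t : Option (Fin d) → ℝ := fun o => o.elim 0 fun a => (a : ℝ) + 1
  have ht : ∀ o, 0 ≤ t o := by
    rintro (_ | a) <;> simp only [t, Option.elim] <;> positivity
  have ht0 : t none = 0 := rfl
  have htinj : Function.Injective t := by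
    rintro (_ | a) (_ | b) h
    · rfl
    · simp only [t, Option.elim] at h
      exact absurd h (by positivity)
    · simp only [t, Option.elim] at h
      exact absurd h (by positivity)
    · simp only [t, Option.elim, add_left_inj, Nat.cast_inj] at h
      rw [Fin.ext h]
  let v : Fin n → ℍ[ℝ] := fun i => (ξ i : ℍ[ℝ]ˣ) * ((t (c i) : ℝ) : ℍ[ℝ])
  have hv : ∀ i, ‖v i‖ = t (c i) := fun i => by
    simp only [v]
    rw [norm_mul, norm_eq_one_of_finite, one_mul, Quaternion.norm_coe, Real.norm_of_nonneg (ht _)]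
  refine ⟨{v}, fun g => ?_⟩
  rw [← SetLike.mem_coe, hP, mem_reflGroup_iff]
  constructor
  · rintro ⟨θ, σ, h1, rfl, h2, h3⟩
    refine ⟨⟨θ, σ, h1, rfl⟩, ?_⟩
    rintro u rfl
    rw [monomial_mulVec_eq_iff]
    intro i
    simp only [v, h2]
    by_cases hi : c i = none
    · simp [hi, ht0]
    · rw [← h3 i hi, ← mul_assoc]
      simp
  · rintro ⟨⟨θ, σ, h1, rfl⟩, h2⟩
    have h3 := (monomial_mulVec_eq_iff _ _ _).1 (h2 v rfl)
    have hc : ∀ i, c (σ i) = c i := fun i => htinj <| by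
      rw [← hv, ← hv, ← h3 i, norm_mul, norm_eq_one_of_finite, one_mul]
    refine ⟨θ, σ, h1, rfl, hc, fun i hi => ?_⟩
    have e := h3 i
    simp only [v, hc, ← mul_assoc] at e
    have hne : ((t (c i) : ℝ) : ℍ[ℝ]) ≠ 0 := by
      intro h
      have h' : t (c i) = 0 := Quaternion.coe_injective h
      exact hi (htinj (h'.trans ht0.symm))
    have e2 := mul_right_cancel₀ hne e
    ext1
    ext1
    simpa using e2

/-- Permutations preserving a colouring are generated by the transpositions which preserve it. -/
theorem mem_closure_swap_of_color {α β : Type*} [Finite α] [DecidableEq α] {c : α → β}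
    {σ : Equiv.Perm α} (h : ∀ i, c (σ i) = c i) :
    σ ∈ Subgroup.closure {τ : Equiv.Perm α | ∃ i j, i ≠ j ∧ c i = c j ∧ τ = Equiv.swap i j} := by
  rw [mem_closure_isSwap]
  · refine ⟨Set.toFinite _, fun x => ?_⟩
    by_cases hx : σ x = x
    · rw [hx]
      exact MulAction.mem_orbit_self _
    · exact ⟨⟨Equiv.swap (σ x) x, Subgroup.subset_closure ⟨_, _, hx, h x, rfl⟩⟩,
        Equiv.swap_apply_right _ _⟩
  · rintro _ ⟨i, j, hij, -, rfl⟩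
    exact ⟨i, j, hij, rfl⟩

/-- `diag(ξ) M(σ) diag(ξ)⁻¹`. -/
theorem monomial_conj_perm (ξ : Fin n → ℍ[ℝ]ˣ) (σ : Equiv.Perm (Fin n)) :
    monomial ξ 1 * monomial 1 σ * (monomial ξ 1)⁻¹ =
      monomial (fun i => ξ i * (ξ (σ⁻¹ i))⁻¹) σ := by
  rw [monomial_conj]
  congr 1
  funext i
  simp

theorem mem_symmGroupOn_iff {S : Finset (Fin n)} {ξ : Fin n → ℍ[ℝ]ˣ} {g : GLH n} :
    g ∈ symmGroupOn S ξ ↔ ∃ σ : Equiv.Perm (Fin n), (∀ i ∉ S, σ i = i) ∧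
      g = monomial (fun i => ξ i * (ξ (σ⁻¹ i))⁻¹) σ := by
  simp only [symmGroupOn, Subgroup.mem_map, exists_exists_and_eq_and, mem_fixingSubgroup_iff,
    MulEquiv.coe_toMonoidHom, MulAut.conj_apply, permHom, MonoidHom.coe_mk, OneHom.coe_mk]
  simp only [monomial_conj_perm, Set.mem_compl_iff, Finset.mem_coe, Equiv.Perm.smul_def]
  exact exists_congr fun σ => and_congr Iff.rfl eq_comm

/-- The group attached to a triple `(I₀, Π, ξ)` consists of the elements given by the colouring
with colour classes the blocks of `Π`. -/
theorem coe_tripleGroup {hKH : commutator K ≤ H} {d : ℕ} {I₀ : Finset (Fin n)}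
    {I : Fin d → Finset (Fin n)} {c : Fin n → Option (Fin d)} (ξ : Fin n → K)
    (hI₀ : ∀ j, j ∈ I₀ ↔ c j = none) (hI : ∀ a j, j ∈ I a ↔ c j = some a) :
    (tripleGroup K H hKH I₀ I ξ : Set (GLH n)) = colorStab H c ξ := by
  obtain rfl : I₀ = ({i | c i = none} : Finset (Fin n)) := by
    ext j
    simp [hI₀]
  obtain rfl : I = fun a => ({i | c i = some a} : Finset (Fin n)) := by
    funext a
    ext j
    simp [hI]
  have hpm := fun θ : Fin n → K => prod_mem_iff hKH θ
  have htel : ∀ σ : Equiv.Perm (Fin n), (List.ofFn fun i => ξ i * (ξ (σ⁻¹ i))⁻¹).prod ∈ H := by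
    intro σ
    rw [hpm]
    simp only [map_mul, map_inv, Finset.prod_mul_distrib, Finset.prod_inv_distrib]
    rw [Equiv.prod_comp σ⁻¹ (fun i => Abelianization.of (ξ i)), mul_inv_cancel]
    exact one_mem _
  set T := tripleGroup K H hKH {i | c i = none} (fun a => {i | c i = some a}) ξ
  have hT0 : reflGroupOn K H hKH {i | c i = none} ≤ T := le_sup_left
  have hTa : ∀ a, symmGroupOn {i | c i = some a} (fun j => (ξ j : ℍ[ℝ]ˣ)) ≤ T := fun a =>
    (le_iSup (fun a => symmGroupOn {i | c i = some a} (fun j => (ξ j : ℍ[ℝ]ˣ))) a).trans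
      le_sup_right
  -- the right-hand side is a subgroup, so that it is enough to look at generators
  let S : Subgroup (GLH n) :=
    { carrier := colorStab H c ξ
      one_mem' := by
        have h := monomial_mem_colorStab_iff (H := H) (c := c) (ξ := ξ) (θ := 1) (σ := 1)
        refine (monomial_one (n := n)) ▸ h.2 ⟨?_, by simp, by simp⟩
        rw [hpm]
        simp [one_mem]
      mul_mem' := by
        rintro _ _ ⟨θ, σ, hp, rfl, hc, h⟩ ⟨θ', σ', hp', rfl, hc', h'⟩
        refine ⟨fun i => θ i * θ' (σ⁻¹ i), σ * σ', ?_, by rw [monomial_mul]; rfl, ?_, ?_⟩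
        · rw [hpm] at hp hp' ⊢
          simp only [map_mul, Finset.prod_mul_distrib]
          rw [Equiv.prod_comp σ⁻¹ (fun i => Abelianization.of (θ' i))]
          exact mul_mem hp hp'
        · intro i
          simp [hc, hc']
        · intro i hi
          have h2 := h (σ' i) (by rwa [hc'])
          simpa [mul_assoc, h' i hi] using h2
      inv_mem' := by
        rintro _ ⟨θ, σ, hp, rfl, hc, h⟩
        have hc1 : ∀ i, c (σ⁻¹ i) = c i := fun i => by
          rw [← hc (σ⁻¹ i)]
          simp
        refine ⟨fun i => (θ (σ i))⁻¹, σ⁻¹, ?_, by rw [monomial_inv]; rfl, hc1, ?_⟩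
        · rw [hpm] at hp ⊢
          simp only [map_inv, Finset.prod_inv_distrib]
          rw [Equiv.prod_comp σ (fun i => Abelianization.of (θ i))]
          exact inv_mem hp
        · intro i hi
          have h2 := h (σ⁻¹ i) (by rwa [hc1])
          beta_reduce
          rw [show σ (σ⁻¹ i) = i from σ.apply_symm_apply i] at h2 ⊢
          rw [← h2, inv_mul_cancel_left] }
  have hTS : T ≤ S := by
    refine sup_le ?_ (iSup_le fun a => ?_)
    · rintro _ ⟨θ, σ, hs, hp, rfl⟩
      refine ⟨θ, σ, hp, rfl, fun i => ?_, fun i hi => ?_⟩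
      · by_cases hi : c i = none
        · by_contra hcon
          have h1 : σ i ∉ ({i | c i = none} : Finset (Fin n)) := by
            rw [hi] at hcon
            simpa using hcon
          have h2 := σ.injective (hs _ h1).2
          rw [h2] at hcon
          exact hcon rfl
        · rw [(hs i (by simpa using hi)).2]
      · obtain ⟨h1, h2⟩ := hs i (by simpa using hi)
        rw [h2, h1, one_mul]
    · intro g hg
      obtain ⟨σ, hs, rfl⟩ := mem_symmGroupOn_iff.1 hg
      have h := monomial_mem_colorStab_iff (H := H) (c := c) (ξ := ξ)
        (θ := fun i => ξ i * (ξ (σ⁻¹ i))⁻¹) (σ := σ)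
      refine h.2 ⟨htel σ, fun i => ?_, fun i hi => by simp⟩
      by_cases hi : c i = some a
      · by_contra hcon
        have h1 : σ i ∉ ({i | c i = some a} : Finset (Fin n)) := by
          rw [hi] at hcon
          simpa using hcon
        have h2 := σ.injective (hs _ h1)
        rw [h2] at hcon
        exact hcon rfl
      · rw [hs i (by simpa using hi)]
  refine Set.Subset.antisymm hTS ?_
  -- the permutations of the `ξ(j) e_j` lie in `T`, by reduction to transpositions
  have hperm : ∀ σ : Equiv.Perm (Fin n), (∀ i, c (σ i) = c i) →
      monomial (fun i => (ξ i : ℍ[ℝ]ˣ) * (ξ (σ⁻¹ i) : ℍ[ℝ]ˣ)⁻¹) σ ∈ T := by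
    intro σ hσ
    let φ : Equiv.Perm (Fin n) →* GLH n :=
      (MulAut.conj (monomial (fun i => (ξ i : ℍ[ℝ]ˣ)) 1)).toMonoidHom.comp (permHom n)
    have hφ : ∀ σ, φ σ = monomial (fun i => (ξ i : ℍ[ℝ]ˣ) * (ξ (σ⁻¹ i) : ℍ[ℝ]ˣ)⁻¹) σ := fun σ =>
      monomial_conj_perm _ σ
    rw [← hφ]
    suffices hle : Subgroup.closure
        {τ : Equiv.Perm (Fin n) | ∃ i j, i ≠ j ∧ c i = c j ∧ τ = Equiv.swap i j} ≤ T.comap φ from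
      hle (mem_closure_swap_of_color hσ)
    rw [Subgroup.closure_le]
    rintro _ ⟨i, j, -, hij, rfl⟩
    rw [SetLike.mem_coe, Subgroup.mem_comap, hφ]
    have hfix : ∀ o, c i = o → ∀ k, c k ≠ o → Equiv.swap i j k = k := by
      rintro o rfl k hk
      refine Equiv.swap_apply_of_ne_of_ne ?_ ?_
      · rintro rfl
        exact hk rfl
      · rintro rfl
        exact hk hij.symm
    rcases hi : c i with _ | a
    · refine hT0 ⟨fun k => ξ k * (ξ ((Equiv.swap i j)⁻¹ k))⁻¹, Equiv.swap i j, fun k hk => ?_,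
        htel _, rfl⟩
      have := hfix none hi k (by simpa using hk)
      refine ⟨?_, this⟩
      simp only
      rw [Equiv.swap_inv, this, mul_inv_cancel]
    · refine hTa a (mem_symmGroupOn_iff.2 ⟨_, fun k hk => ?_, rfl⟩)
      exact hfix (some a) hi k (by simpa using hk)
  rintro _ ⟨θ, σ, hp, rfl, hc, h⟩
  have hc1 : ∀ i, c (σ⁻¹ i) = c i := fun i => by
    rw [← hc (σ⁻¹ i)]
    simp
  -- what remains after splitting off `diag(ξ) M(σ) diag(ξ)⁻¹` is a diagonal matrix in `P₀`
  have hdiag : monomial (fun i => ((θ i * (ξ i * (ξ (σ⁻¹ i))⁻¹)⁻¹ : K) : ℍ[ℝ]ˣ)) 1 ∈ T := by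
    refine hT0 ⟨fun i => θ i * (ξ i * (ξ (σ⁻¹ i))⁻¹)⁻¹, 1, fun i hi => ⟨?_, rfl⟩, ?_, rfl⟩
    · have h2 := h (σ⁻¹ i) (by rw [hc1]; simpa using hi)
      rw [show σ (σ⁻¹ i) = i from σ.apply_symm_apply i] at h2
      simp only
      rw [mul_inv_eq_one, ← h2, mul_inv_cancel_right]
    · have ht := htel σ
      rw [hpm] at hp ht ⊢
      simp only [map_mul (Abelianization.of (G := K)) (θ _), map_inv,
        Finset.prod_mul_distrib (f := fun i => Abelianization.of (θ i)),
        Finset.prod_inv_distrib]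
      exact mul_mem hp (inv_mem ht)
  have := mul_mem hdiag (hperm σ hc)
  rw [monomial_mul, one_mul] at this
  rw [SetLike.mem_coe]
  convert this using 2
  funext i
  simp
  group

/-! ### Conjugation of colourings -/

/-- The permutation `τ` carries the partition into colour classes of `c` to that of `c'`, and the
uncoloured elements of `c` to those of `c'`. The names of the colours are irrelevant. -/
structure ColorIso {α ι κ : Type*} (c : α → Option ι) (c' : α → Option κ)
    (τ : Equiv.Perm α) : Prop where
  eq_iff : ∀ i j, c' (τ i) = c' (τ j) ↔ c i = c j
  none_iff : ∀ i, c' (τ i) = none ↔ c i = none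

theorem ColorIso.symm {α ι κ : Type*} {c : α → Option ι} {c' : α → Option κ}
    {τ : Equiv.Perm α} (h : ColorIso c c' τ) : ColorIso c' c τ⁻¹ where
  eq_iff i j := by
    rw [← h.eq_iff, show τ (τ⁻¹ i) = i from τ.apply_symm_apply i,
      show τ (τ⁻¹ j) = j from τ.apply_symm_apply j]
  none_iff i := by rw [← h.none_iff, show τ (τ⁻¹ i) = i from τ.apply_symm_apply i]

theorem prod_conj {φ θ : Fin n → K} {σ τ : Equiv.Perm (Fin n)} (hφ : ∏ i, f (φ i) = 1) :
    ∏ i, f (θ i * φ (τ⁻¹ i) * (θ (τ (σ⁻¹ (τ⁻¹ i))))⁻¹) = 1 := by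
  simp only [map_mul, map_inv, Finset.prod_mul_distrib, Finset.prod_inv_distrib]
  rw [Equiv.prod_comp τ⁻¹ (fun i => f (φ i)), hφ, mul_one, mul_inv_eq_one]
  exact (Equiv.prod_comp (τ * σ⁻¹ * τ⁻¹) (fun i => f (θ i))).symm

theorem monomial_conj_mem_colorStab_iff {ι : Type*} (hf : f.ker = H) {c : Fin n → Option ι}
    {ξ : Fin n → K} {φ θ : Fin n → K} {σ τ : Equiv.Perm (Fin n)} (hφ : (List.ofFn φ).prod ∈ H) :
    monomial (fun i => (θ i : ℍ[ℝ]ˣ)) τ * monomial (fun i => (φ i : ℍ[ℝ]ˣ)) σ *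
        (monomial (fun i => (θ i : ℍ[ℝ]ˣ)) τ)⁻¹ ∈ colorStab H c ξ ↔
      (∀ i, c (τ (σ i)) = c (τ i)) ∧
        ∀ i, c (τ i) ≠ none → θ (τ (σ i)) * φ (σ i) * (θ (τ i))⁻¹ * ξ (τ i) = ξ (τ (σ i)) := by
  have h := monomial_mem_colorStab_iff (H := H) (c := c) (ξ := ξ)
    (θ := fun i => θ i * φ (τ⁻¹ i) * (θ (τ (σ⁻¹ (τ⁻¹ i))))⁻¹) (σ := τ * σ * τ⁻¹)
  rw [monomial_conj]
  rw [prod_mem_iff_of_ker hf] at hφ h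
  refine h.trans ((and_iff_right (prod_conj hφ)).trans ?_)
  rw [← τ.forall_congr_right (q := fun i => c ((τ * σ * τ⁻¹) i) = c i),
    ← τ.forall_congr_right (q := fun i => c i ≠ none → _)]
  simp

theorem conj_mem_colorStab {ι κ : Type*} (hf : f.ker = H) {c : Fin n → Option ι}
    {c' : Fin n → Option κ} {ξ ξ' θ : Fin n → K} {τ : Equiv.Perm (Fin n)} (h : ColorIso c c' τ)
    (hθ : ∀ i j, c i = c j → c i ≠ none →
      (ξ' (τ i))⁻¹ * θ (τ i) * ξ i = (ξ' (τ j))⁻¹ * θ (τ j) * ξ j)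
    {g : GLH n} (hg : g ∈ colorStab H c ξ) :
    monomial (fun i => (θ i : ℍ[ℝ]ˣ)) τ * g * (monomial (fun i => (θ i : ℍ[ℝ]ˣ)) τ)⁻¹ ∈
      colorStab H c' ξ' := by
  obtain ⟨φ, σ, hφ, rfl, hc, hξ⟩ := hg
  rw [monomial_conj_mem_colorStab_iff hf hφ]
  refine ⟨fun i => (h.eq_iff _ _).2 (hc i), fun i hi => ?_⟩
  have hi' : c i ≠ none := fun h0 => hi ((h.none_iff i).2 h0)
  have e1 := hξ i hi'
  have e2 := hθ (σ i) i (hc i) (by rwa [hc])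
  rw [← eq_mul_inv_iff_mul_eq] at e1
  rw [e1]
  have e3 : θ (τ (σ i)) * ξ (σ i) = ξ' (τ (σ i)) * ((ξ' (τ i))⁻¹ * θ (τ i) * ξ i) := by
    rw [← e2]
    group
  rw [← mul_assoc, e3]
  group

/-- A criterion for conjugacy: the colour classes match, and on each class the scalars match up to
a common factor from the right. -/
theorem isConjIn_of_colorIso {ι κ : Type*} {hKH : commutator K ≤ H} (hf : f.ker = H)
    {P P' : Subgroup (GLH n)} {c : Fin n → Option ι} {c' : Fin n → Option κ} {ξ ξ' θ : Fin n → K}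
    {τ : Equiv.Perm (Fin n)} (hP : (P : Set (GLH n)) = colorStab H c ξ)
    (hP' : (P' : Set (GLH n)) = colorStab H c' ξ') (h : ColorIso c c' τ)
    (hθ1 : ∏ i, f (θ i) = 1)
    (hθ : ∀ i j, c i = c j → c i ≠ none →
      (ξ' (τ i))⁻¹ * θ (τ i) * ξ i = (ξ' (τ j))⁻¹ * θ (τ j) * ξ j) :
    IsConjIn (reflGroup n K H hKH) P P' := by
  refine ⟨monomial (fun i => (θ i : ℍ[ℝ]ˣ)) τ,
    mem_reflGroup_iff.2 ⟨θ, τ, (prod_mem_iff_of_ker hf θ).2 hθ1, rfl⟩, ?_⟩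
  set g := monomial (fun i => (θ i : ℍ[ℝ]ˣ)) τ with hg
  have hginv : g⁻¹ = monomial (fun i => (((θ (τ i))⁻¹ : K) : ℍ[ℝ]ˣ)) τ⁻¹ := by
    rw [hg, monomial_inv]
    rfl
  apply le_antisymm
  · rintro _ ⟨x, hx, rfl⟩
    rw [← SetLike.mem_coe, hP']
    rw [hP] at hx
    exact conj_mem_colorStab hf h hθ hx
  · intro y hy
    rw [← SetLike.mem_coe, hP'] at hy
    refine ⟨g⁻¹ * y * g, ?_, by simp [mul_assoc]⟩
    rw [hP]
    have := conj_mem_colorStab (θ := fun i => (θ (τ i))⁻¹) hf h.symm (ξ := ξ') (ξ' := ξ) ?_ hy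
    · rw [← hginv, inv_inv] at this
      exact this
    · intro i j hij hi
      obtain ⟨i, rfl⟩ := τ.surjective i
      obtain ⟨j, rfl⟩ := τ.surjective j
      have e := hθ i j ((h.eq_iff _ _).1 hij) fun h0 => hi ((h.none_iff i).2 h0)
      have e' := congrArg (·⁻¹) e
      simpa [mul_assoc] using e'

/-- Half of the converse of `isConjIn_of_colorIso`. Uncoloured coordinates are recognized by the
diagonal matrices with a single nontrivial entry, which exist because `H ≠ 1`, and colour classes
by the transpositions of two of the `ξ(j) e_j`. -/
theorem color_of_conj_mem {ι κ : Type*} (hH : H ≠ ⊥) (hf : f.ker = H)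
    {c : Fin n → Option ι} {c' : Fin n → Option κ} {ξ ξ' θ : Fin n → K} {τ : Equiv.Perm (Fin n)}
    (h : ∀ g ∈ colorStab H c ξ,
      monomial (fun i => (θ i : ℍ[ℝ]ˣ)) τ * g * (monomial (fun i => (θ i : ℍ[ℝ]ˣ)) τ)⁻¹ ∈
        colorStab H c' ξ') :
    (∀ i, c i = none → c' (τ i) = none) ∧ (∀ i j, c i = c j → c' (τ i) = c' (τ j)) ∧
      ∀ i j, c i = c j → c' (τ i) ≠ none →
        (ξ' (τ i))⁻¹ * θ (τ i) * ξ i = (ξ' (τ j))⁻¹ * θ (τ j) * ξ j := by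
  have hswap : ∀ i j, c i = c j → c' (τ j) = c' (τ i) ∧ (c' (τ i) ≠ none →
      θ (τ j) * (ξ j * (ξ i)⁻¹) * (θ (τ i))⁻¹ * ξ' (τ i) = ξ' (τ j)) := by
    intro i j hij
    have hp : (List.ofFn fun k => ξ k * (ξ ((Equiv.swap i j)⁻¹ k))⁻¹).prod ∈ H := by
      rw [prod_mem_iff_of_ker hf]
      simp only [map_mul, map_inv, Finset.prod_mul_distrib, Finset.prod_inv_distrib]
      rw [Equiv.prod_comp (Equiv.swap i j)⁻¹ (fun i => f (ξ i)), mul_inv_cancel]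
    have hc : ∀ k, c (Equiv.swap i j k) = c k := by
      intro k
      rw [Equiv.swap_apply_def]
      split_ifs with h1 h2
      · rw [h1, hij]
      · rw [h2, hij]
      · rfl
    have := h _ (monomial_mem_colorStab_iff.2 ⟨hp, hc, by simp⟩)
    rw [monomial_conj_mem_colorStab_iff hf hp] at this
    refine ⟨?_, fun h0 => ?_⟩
    · simpa using this.1 i
    · simpa using this.2 i h0
  refine ⟨fun i hi => ?_, fun i j hij => ((hswap i j hij).1).symm, fun i j hij hi => ?_⟩
  · by_contra hcon
    obtain ⟨k, hk, hk1⟩ := H.bot_or_exists_ne_one.resolve_left hH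
    have hfk : f k = 1 := by
      rw [← hf] at hk
      exact hk
    have hp : (List.ofFn (Pi.mulSingle i k)).prod ∈ H := by
      rw [prod_mem_iff_of_ker hf]
      refine Finset.prod_eq_one fun j _ => ?_
      by_cases hj : j = i
      · subst hj
        simp [hfk]
      · simp [Pi.mulSingle_eq_of_ne hj]
    have hmem : monomial (fun j => ((Pi.mulSingle i k : Fin n → K) j : ℍ[ℝ]ˣ)) 1 ∈
        colorStab H c ξ := by
      refine monomial_mem_colorStab_iff.2 ⟨hp, fun _ => rfl, fun j hj => ?_⟩
      have hne : j ≠ i := by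
        rintro rfl
        exact hj hi
      simp [Pi.mulSingle_eq_of_ne hne]
    have := h _ hmem
    rw [monomial_conj_mem_colorStab_iff hf hp] at this
    have e := this.2 i hcon
    simp only [Equiv.Perm.coe_one, id_eq, Pi.mulSingle_eq_same, mul_eq_right,
      conj_eq_one_iff] at e
    exact hk1 e
  · have e := (hswap i j hij).2 hi
    rw [← e]
    group

/-- Conjugate groups have matching colour classes, and on each class the scalars match up to a
common factor from the right. -/
theorem IsConjIn.exists_colorIso {ι κ : Type*} {hKH : commutator K ≤ H} (hH : H ≠ ⊥)
    (hf : f.ker = H) {P P' : Subgroup (GLH n)} {c : Fin n → Option ι} {c' : Fin n → Option κ}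
    {ξ ξ' : Fin n → K} (hP : (P : Set (GLH n)) = colorStab H c ξ)
    (hP' : (P' : Set (GLH n)) = colorStab H c' ξ')
    (h : IsConjIn (reflGroup n K H hKH) P P') :
    ∃ (θ : Fin n → K) (τ : Equiv.Perm (Fin n)), ColorIso c c' τ ∧ ∏ i, f (θ i) = 1 ∧
      ∀ i j, c i = c j → c i ≠ none →
        (ξ' (τ i))⁻¹ * θ (τ i) * ξ i = (ξ' (τ j))⁻¹ * θ (τ j) * ξ j := by
  obtain ⟨g, hg, rfl⟩ := h
  obtain ⟨θ, τ, hp, hgeq⟩ := mem_reflGroup_iff.1 hg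
  have hginv : g⁻¹ = monomial (fun i => (((θ (τ i))⁻¹ : K) : ℍ[ℝ]ˣ)) τ⁻¹ := by
    rw [hgeq, monomial_inv]
    rfl
  have h1 : ∀ x ∈ colorStab H c ξ, g * x * g⁻¹ ∈ colorStab H c' ξ' := by
    intro x hx
    rw [← hP']
    rw [← hP] at hx
    exact Subgroup.mem_map_of_mem (MulAut.conj g).toMonoidHom hx
  have h2 : ∀ x ∈ colorStab H c' ξ', g⁻¹ * x * g⁻¹⁻¹ ∈ colorStab H c ξ := by
    intro x hx
    rw [← hP'] at hx
    obtain ⟨y, hy, rfl⟩ := hx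
    rw [← hP]
    simpa [mul_assoc] using hy
  rw [hgeq] at h1
  rw [hginv] at h2
  obtain ⟨n1, c1, s1⟩ := color_of_conj_mem hH hf h1
  obtain ⟨n2, c2, -⟩ := color_of_conj_mem (θ := fun i => (θ (τ i))⁻¹) hH hf h2
  have hiso : ColorIso c c' τ :=
    { eq_iff := fun i j => ⟨fun h => by simpa using c2 _ _ h, c1 i j⟩
      none_iff := fun i => ⟨fun h => by simpa using n2 _ h, n1 i⟩ }
  exact ⟨θ, τ, hiso, (prod_mem_iff_of_ker hf θ).1 hp, fun i j hij hi =>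
    s1 i j hij fun h0 => hi ((hiso.none_iff i).1 h0)⟩

/-! ### Shapes of colourings -/

/-- The multiset of the sizes of the colour classes; the uncoloured elements do not count. -/
def shape {α ι : Type*} [Fintype α] [DecidableEq ι] (c : α → Option ι) : Multiset ℕ :=
  ((Finset.univ.image c).erase none).val.map fun o => Finset.card {i | c i = o}

section

variable {α ι κ : Type*} [Fintype α] [DecidableEq ι] [DecidableEq κ]
  {c : α → Option ι} {c' : α → Option κ}

theorem pos_of_mem_shape {k : ℕ} (hk : k ∈ shape c) : 0 < k := by
  simp only [shape, Multiset.mem_map, Finset.mem_val, Finset.mem_erase, Finset.mem_image,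
    Finset.mem_univ, true_and] at hk
  obtain ⟨o, ⟨-, i, hi⟩, rfl⟩ := hk
  exact Finset.card_pos.2 ⟨i, by simpa using hi⟩

theorem sum_shape_add_card_none :
    (shape c).sum + Finset.card {i | c i = none} = Fintype.card α := by
  have h1 : (shape c).sum = ∑ o ∈ (Finset.univ.image c).erase none,
      Finset.card {i | c i = o} := rfl
  have h2 : Fintype.card α = ∑ o ∈ insert none (Finset.univ.image c),
      Finset.card {i | c i = o} := by
    rw [← Finset.card_univ]
    exact Finset.card_eq_sum_card_fiberwise fun i _ => by simp
  rw [h2, h1, ← Finset.sum_erase_add _ _ (Finset.mem_insert_self none _),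
    Finset.erase_insert_eq_erase]

theorem ColorIso.shape_eq {τ : Equiv.Perm α} (h : ColorIso c c' τ) : shape c = shape c' := by
  have hex : ∀ o ∈ ((Finset.univ.image c).erase none).val, ∃ i, c i = o := by
    intro o ho
    simpa using (Finset.mem_erase.1 ho).2
  refine Multiset.map_eq_map_of_bij_of_nodup _ _ (Finset.nodup _) (Finset.nodup _)
    (fun o ho => c' (τ (hex o ho).choose)) ?_ ?_ ?_ ?_
  · intro o ho
    have h1 := (hex o ho).choose_spec
    simp only [Finset.mem_val, Finset.mem_erase, Finset.mem_image, Finset.mem_univ, true_and,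
      exists_apply_eq_apply, and_true]
    intro h0
    rw [h.none_iff, h1] at h0
    exact (Finset.mem_erase.1 ho).1 h0
  · intro o ho o' ho' heq
    rwa [h.eq_iff, (hex o ho).choose_spec, (hex o' ho').choose_spec] at heq
  · intro o ho
    obtain ⟨h0, h1⟩ := Finset.mem_erase.1 ho
    obtain ⟨j, -, rfl⟩ := Finset.mem_image.1 h1
    obtain ⟨i, rfl⟩ := τ.surjective j
    have hi : c i ∈ ((Finset.univ.image c).erase none).val := by
      rw [Finset.mem_val]
      simpa using fun h2 => h0 ((h.none_iff i).2 h2)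
    exact ⟨c i, hi, (h.eq_iff _ _).2 (hex _ hi).choose_spec⟩
  · intro o ho
    have h1 := (hex o ho).choose_spec
    refine Finset.card_equiv τ fun i => ?_
    simp only [Finset.mem_filter_univ, h.eq_iff, h1]

end

/-- Two functions whose fibres have the same sizes differ by a bijection of their domains. -/
theorem exists_equiv_comp_eq {α β γ : Type*} [Fintype α] [Fintype β] [DecidableEq γ] {p : α → γ}
    {q : β → γ}
    (h : ∀ x, Finset.card {i | p i = x} = Finset.card {i | q i = x}) :
    ∃ e : α ≃ β, ∀ i, q (e i) = p i := by
  have e : ∀ x, Nonempty ({i // p i = x} ≃ {i // q i = x}) := fun x =>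
    ⟨Fintype.equivOfCardEq (by rw [Fintype.card_subtype, Fintype.card_subtype, h x])⟩
  exact ⟨Equiv.ofFiberEquiv fun x => (e x).some, fun i => Equiv.ofFiberEquiv_map _ i⟩

theorem card_filter_subtype_eq_count {α γ : Type*} [DecidableEq γ] (s : Finset α) (p : α → γ)
    (x : γ) : Finset.card {i : s | p i = x} = (s.val.map p).count x := by
  rw [Multiset.count_map, Finset.univ_eq_attach, Finset.filter_attach (fun i => p i = x),
    Finset.card_map, Finset.card_attach]
  simp only [eq_comm (a := x)]
  rfl

/-- Equality of images as multisets comes from a bijection. -/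
theorem exists_equiv_of_map_eq {α β γ : Type*} [DecidableEq γ] {s : Finset α} {t : Finset β}
    {p : α → γ} {q : β → γ} (h : s.val.map p = t.val.map q) : ∃ e : s ≃ t, ∀ i, q (e i) = p i :=
  exists_equiv_comp_eq (p := fun i : s => p i) (q := fun i : t => q i) fun x => by
    rw [card_filter_subtype_eq_count, card_filter_subtype_eq_count, h]

/-- The shape determines a colouring up to a permutation and the names of the colours. -/
theorem exists_colorIso_of_shape_eq {α ι κ : Type*} [Fintype α] [DecidableEq ι] [DecidableEq κ]
    {c : α → Option ι} {c' : α → Option κ} (h : shape c = shape c') :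
    ∃ τ, ColorIso c c' τ := by
  obtain ⟨e, he⟩ := exists_equiv_of_map_eq h
  have hnone : Finset.card {i | c i = none} = Finset.card {i | c' i = none} := by
    have h1 := sum_shape_add_card_none (c := c)
    have h2 := sum_shape_add_card_none (c := c')
    rw [h] at h1
    omega
  have hmem : ∀ i, c i ≠ none → c i ∈ (Finset.univ.image c).erase none := fun i hi => by simp [hi]
  -- renaming of the colours of `c` by colours of `c'`
  let r : Option ι → Option κ := fun o =>
    if ho : o ∈ (Finset.univ.image c).erase none then (e ⟨o, ho⟩ : Option κ) else none
  have hr : ∀ o (ho : o ∈ (Finset.univ.image c).erase none), r o = e ⟨o, ho⟩ :=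
    fun o ho => dif_pos ho
  have hr0 : ∀ i, r (c i) = none ↔ c i = none := by
    intro i
    by_cases hi : c i = none
    · simp [r, hi]
    · rw [hr _ (hmem i hi)]
      exact iff_of_false (Finset.mem_erase.1 (e ⟨c i, hmem i hi⟩).2).1 hi
  have hrinj : ∀ i j, r (c i) = r (c j) → c i = c j := by
    intro i j hij
    by_cases hi : c i = none
    · rw [(hr0 i).2 hi, eq_comm, hr0] at hij
      rw [hi, hij]
    · have hj : c j ≠ none := by rwa [Ne, ← hr0, ← hij, hr0]
      rw [hr _ (hmem i hi), hr _ (hmem j hj), Subtype.coe_inj, e.apply_eq_iff_eq] at hij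
      exact congrArg Subtype.val hij
  have hfib : ∀ x, Finset.card {i | r (c i) = x} = Finset.card {i | c' i = x} := by
    intro x
    -- only colours of `c'` matter, and each is the new name of one colour of `c`, of equal size
    rcases eq_or_ne x none with rfl | hx0
    · simp only [hr0, hnone]
    by_cases hx : x ∈ (Finset.univ.image c').erase none
    · obtain ⟨⟨o, ho⟩, hoe⟩ := e.surjective ⟨x, hx⟩
      have h1 := he ⟨o, ho⟩
      rw [hoe] at h1
      obtain ⟨i, -, rfl⟩ := Finset.mem_image.1 (Finset.mem_erase.1 ho).2
      have h2 : x = r (c i) := by rw [hr _ ho, hoe]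
      simp only at h1
      rw [h1, h2]
      congr 1
      ext j
      simpa using ⟨hrinj j i, congrArg r⟩
    · rw [Finset.card_eq_zero.2, Finset.card_eq_zero.2]
      · rw [Finset.filter_eq_empty_iff]
        rintro i - rfl
        exact hx (by simp [hx0])
      · rw [Finset.filter_eq_empty_iff]
        rintro i - rfl
        have hi : c i ≠ none := fun h0 => hx0 ((hr0 i).2 h0)
        rw [hr _ (hmem i hi)] at hx
        exact hx (e _).2
  obtain ⟨τ, hτ⟩ := exists_equiv_comp_eq hfib
  refine ⟨τ, ⟨fun i j => ?_, fun i => by rw [hτ, hr0]⟩⟩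
  rw [hτ, hτ]
  exact ⟨hrinj i j, congrArg r⟩

/-! ### The colouring of a partition -/

/-- The composition whose blocks are the parts of a partition in decreasing order. -/
def partitionComposition {m : ℕ} (lam : m.Partition) : Composition m where
  blocks := sortedParts lam
  blocks_pos hi := lam.parts_pos ((Multiset.mem_sort _).1 hi)
  blocks_sum := by rw [← Multiset.sum_coe, sortedParts, Multiset.sort_eq, lam.parts_sum]

/-- The colouring of the first `m` of `n` coordinates by the blocks of a partition of `m`. -/
def partitionColor (n : ℕ) {m : ℕ} (lam : m.Partition) (j : Fin n) :
    Option (Fin (partitionComposition lam).length) :=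
  if h : (j : ℕ) < m then some ((partitionComposition lam).index ⟨j, h⟩) else none

theorem partitionColor_eq_none_iff {m : ℕ} {lam : m.Partition} {j : Fin n} :
    partitionColor n lam j = none ↔ m ≤ (j : ℕ) := by
  rw [partitionColor]
  split_ifs with h <;> simp <;> omega

theorem partitionColor_eq_some_iff {m : ℕ} {lam : m.Partition} {j : Fin n}
    {i : Fin (partitionComposition lam).length} :
    partitionColor n lam j = some i ↔ j ∈ block n lam i := by
  simp only [block, Finset.mem_filter_univ]
  change _ ↔ (partitionComposition lam).sizeUpTo i ≤ _ ∧
    _ < (partitionComposition lam).sizeUpTo (i + 1)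
  rw [partitionColor]
  split_ifs with h
  · rw [Option.some_inj, eq_comm]
    exact ((partitionComposition lam).mem_range_embedding_iff' (j := ⟨j, h⟩) (i := i)).symm.trans
      (partitionComposition lam).mem_range_embedding_iff
  · have := (partitionComposition lam).sizeUpTo_le (i + 1)
    simp only [false_iff, not_and]
    omega

theorem shape_partitionColor {m : ℕ} (hm : m ≤ n) (lam : m.Partition) :
    shape (partitionColor n lam) = lam.parts := by
  have hcard : ∀ i, Finset.card {j | partitionColor n lam j = some i} =
      (partitionComposition lam).blocksFun i := by
    intro i
    have : ({j | partitionColor n lam j = some i} : Finset (Fin n)) = (Finset.univ.map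
        ((partitionComposition lam).embedding i).toEmbedding).map (Fin.castLEEmb hm) := by
      ext j
      simp only [Finset.mem_filter_univ, Finset.mem_map, Finset.mem_univ, true_and]
      rw [partitionColor]
      constructor
      · intro h
        split_ifs at h with hj
        rw [Option.some_inj] at h
        exact ⟨⟨j, hj⟩, (partitionComposition lam).mem_range_embedding_iff'.2 h.symm, rfl⟩
      · rintro ⟨j', h, rfl⟩
        have h' := (partitionComposition lam).mem_range_embedding_iff'.1 h
        simp [h']
    rw [this, Finset.card_map, Finset.card_map, Finset.card_univ, Fintype.card_fin]
  have himage : (Finset.univ.image (partitionColor n lam)).erase none =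
      Finset.univ.map Function.Embedding.some := by
    ext o
    rcases o with _ | i
    · simp
    · have hpos : 0 < Finset.card {j | partitionColor n lam j = some i} := by
        rw [hcard]
        exact (partitionComposition lam).one_le_blocksFun i
      obtain ⟨j, hj⟩ := Finset.card_pos.1 hpos
      simpa using ⟨j, by simpa using hj⟩
  rw [shape, himage, Finset.map_val, Multiset.map_map]
  have h1 := (partitionComposition lam).ofFn_blocksFun
  have h3 : ((partitionComposition lam).blocks : Multiset ℕ) = lam.parts := Multiset.sort_eq _ _
  rw [← h3]
  refine Eq.trans ?_ (congrArg _ h1)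
  rw [← Fin.univ_val_map]
  exact Multiset.map_congr rfl fun i _ => hcard i

theorem coe_partitionGroup {hKH : commutator K ≤ H} {m : ℕ} (lam : m.Partition) (α : K) :
    (partitionGroup n K H hKH lam α : Set (GLH n)) =
      colorStab H (partitionColor n lam) (fun j => if (j : ℕ) = 0 then α else 1) :=
  coe_tripleGroup (d := (sortedParts lam).length) _
    (fun j => (Finset.mem_filter_univ j).trans partitionColor_eq_none_iff.symm)
    (fun _ _ => partitionColor_eq_some_iff.symm)

/-! ### Products over colour classes and greatest common divisors -/

/-- Bézout's identity for exponents: every `gcd`-th power is a product of `w a`-th powers. -/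
theorem exists_prod_pow_eq_pow_gcd {ι : Type*} (s : Finset ι) (w : ι → ℕ) (y : A) :
    ∃ z : ι → A, ∏ a ∈ s, z a ^ w a = y ^ s.gcd w := by
  classical
  induction s using Finset.induction_on generalizing y with
  | empty => exact ⟨1, by simp⟩
  | insert b s hb ih =>
    obtain ⟨z, hz⟩ := ih (y ^ Nat.gcdB (w b) (s.gcd w))
    refine ⟨Function.update z b (y ^ Nat.gcdA (w b) (s.gcd w)), ?_⟩
    rw [Finset.prod_insert hb, Function.update_self,
      Finset.prod_congr rfl (g := fun a => z a ^ w a) fun a ha => by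
        rw [Function.update_of_ne (ne_of_mem_of_not_mem ha hb)], hz, Finset.gcd_insert,
      ← zpow_natCast, ← zpow_natCast, ← zpow_natCast, ← zpow_mul, ← zpow_mul, ← zpow_add]
    congr 1
    rw [mul_comm _ (w b : ℤ), mul_comm _ ((s.gcd w : ℕ) : ℤ)]
    exact (Nat.gcd_eq_gcd_ab _ _).symm

theorem exists_prod_pow_eq {ι : Type*} (s : Finset ι) (w : ι → ℕ) (z : ι → A) :
    ∃ y, ∏ a ∈ s, z a ^ w a = y ^ s.gcd w := by
  refine ⟨∏ a ∈ s, z a ^ (w a / s.gcd w), ?_⟩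
  rw [← Finset.prod_pow]
  refine Finset.prod_congr rfl fun a ha => ?_
  rw [← pow_mul, Nat.div_mul_cancel (Finset.gcd_dvd ha)]

theorem prod_comp_color {α ι : Type*} [Fintype α] [DecidableEq ι] {c : α → Option ι}
    (hc : ∀ i, c i ≠ none) (z : Option ι → A) :
    ∏ i, z (c i) = ∏ o ∈ (Finset.univ.image c).erase none, z o ^ Finset.card {i | c i = o} := by
  rw [Finset.prod_comp, Finset.erase_eq_of_notMem]
  simp [hc]

/-- The products over all elements of a factor that depends only on the colour are the powers
whose exponent is the greatest common divisor of the sizes of the colour classes. -/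
theorem exists_prod_eq_pow_gcd_shape {α ι : Type*} [Fintype α] [DecidableEq ι] {c : α → Option ι}
    (hc : ∀ i, c i ≠ none) {r : α → A} (hr : ∀ i j, c i = c j → r i = r j) :
    ∃ y, ∏ i, r i = y ^ (shape c).gcd := by
  have hfac : r.FactorsThrough c := fun i j h => hr i j h
  obtain ⟨y, hy⟩ := exists_prod_pow_eq ((Finset.univ.image c).erase none)
    (fun o => Finset.card {i | c i = o}) (Function.extend c r 1)
  refine ⟨y, ?_⟩
  rw [← prod_comp_color hc] at hy
  simp only [hfac.extend_apply] at hy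
  exact hy

theorem exists_color_prod_eq_pow_gcd_shape {α ι : Type*} [Fintype α] [DecidableEq ι]
    {c : α → Option ι} (hc : ∀ i, c i ≠ none) (y : A) :
    ∃ z : Option ι → A, ∏ i, z (c i) = y ^ (shape c).gcd := by
  obtain ⟨z, hz⟩ := exists_prod_pow_eq_pow_gcd ((Finset.univ.image c).erase none)
    (fun o => Finset.card {i | c i = o}) y
  exact ⟨z, (prod_comp_color hc z).trans hz⟩

/-! ### Classification up to conjugacy -/

section

variable {hKH : commutator K ≤ H} {P P' : Subgroup (GLH n)} {ι κ : Type*} [DecidableEq ι]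
  [DecidableEq κ]
  {c : Fin n → Option ι} {c' : Fin n → Option κ} {ξ ξ' : Fin n → K}

/-- If `I₀` is not empty, the conjugacy class depends on the shape only: the scalars `ξ` can be
transformed at will, because a coordinate in `I₀` takes up the product of the factors. -/
theorem isConjIn_of_shape_eq (hf : f.ker = H) (hP : (P : Set (GLH n)) = colorStab H c ξ)
    (hP' : (P' : Set (GLH n)) = colorStab H c' ξ') (h : shape c = shape c') {i₀ : Fin n}
    (hi₀ : c i₀ = none) : IsConjIn (reflGroup n K H hKH) P P' := by
  obtain ⟨τ, hτ⟩ := exists_colorIso_of_shape_eq h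
  let θ : Fin n → K := fun j => if c' j = none then 1 else ξ' j * (ξ (τ⁻¹ j))⁻¹
  -- the factor at `τ i₀`, where `θ` is not constrained, makes the product trivial
  refine isConjIn_of_colorIso hf hP hP' hτ
    (θ := fun j => θ j * Pi.mulSingle (M := fun _ => K) (τ i₀) (List.ofFn θ).prod⁻¹ j) ?_ ?_
  · simp only [map_mul, Finset.prod_mul_distrib]
    rw [Finset.prod_eq_single (f := fun j => f (Pi.mulSingle (M := fun _ => K) _ _ j)) (τ i₀),
      Pi.mulSingle_eq_same, map_inv, map_list_prod, List.map_ofFn, List.prod_ofFn]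
    · exact mul_inv_cancel _
    · intro j _ hj
      simp [Pi.mulSingle_eq_of_ne hj]
    · simp
  · have key : ∀ i, c i ≠ none → (ξ' (τ i))⁻¹ * (θ (τ i) *
        Pi.mulSingle (M := fun _ => K) (τ i₀) (List.ofFn θ).prod⁻¹ (τ i)) * ξ i = 1 := by
      intro i hi
      have hne : τ i ≠ τ i₀ := fun h => hi (by rw [τ.injective h, hi₀])
      have hi' : c' (τ i) ≠ none := by rwa [Ne, hτ.none_iff]
      rw [Pi.mulSingle_eq_of_ne hne]
      simp [θ, hi']
    intro i j hij hi
    rw [key i hi, key j (hij ▸ hi)]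

/-- The group determines its shape, whether or not `I₀` is empty. -/
theorem IsConjIn.shape_eq (hH : H ≠ ⊥) (hf : f.ker = H)
    (hP : (P : Set (GLH n)) = colorStab H c ξ) (hP' : (P' : Set (GLH n)) = colorStab H c' ξ')
    (h : IsConjIn (reflGroup n K H hKH) P P') : shape c = shape c' := by
  obtain ⟨θ, τ, hτ, -⟩ := h.exists_colorIso hH hf hP hP'
  exact hτ.shape_eq

/-- If `I₀` is empty, the conjugacy class is determined by the shape together with the class of
the product of the `ξ(j)` in `K / H` modulo the `g`-th powers, where `g` is the greatest common
divisor of the sizes of the blocks. -/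
theorem isConjIn_iff (hH : H ≠ ⊥) (hf : f.ker = H) (hsurj : Function.Surjective f)
    (hP : (P : Set (GLH n)) = colorStab H c ξ) (hP' : (P' : Set (GLH n)) = colorStab H c' ξ')
    (hc : ∀ i, c i ≠ none) :
    IsConjIn (reflGroup n K H hKH) P P' ↔
      shape c = shape c' ∧ ∃ y, ∏ i, f (ξ' i) = (∏ i, f (ξ i)) * y ^ (shape c).gcd := by
  constructor
  · intro h
    refine ⟨h.shape_eq hH hf hP hP', ?_⟩
    obtain ⟨θ, τ, hτ, hθ, hr⟩ := h.exists_colorIso hH hf hP hP'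
    obtain ⟨y, hy⟩ := exists_prod_eq_pow_gcd_shape hc
      (r := fun i => f ((ξ' (τ i))⁻¹ * θ (τ i) * ξ i)) fun i j hij => by rw [hr i j hij (hc i)]
    refine ⟨y⁻¹, ?_⟩
    simp only [map_mul, map_inv, Finset.prod_mul_distrib, Finset.prod_inv_distrib] at hy
    rw [Equiv.prod_comp τ (fun i => f (ξ' i)), Equiv.prod_comp τ (fun i => f (θ i)), hθ,
      mul_one] at hy
    rw [inv_pow, ← hy]
    simp
  · rintro ⟨hs, y, hy⟩
    obtain ⟨τ, hτ⟩ := exists_colorIso_of_shape_eq hs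
    obtain ⟨z, hz⟩ := exists_color_prod_eq_pow_gcd_shape hc y⁻¹
    -- `θ` carries `ξ`, multiplied from the right by `k` of the colour, to `ξ'`; Bézout provides
    -- factors `k` which make the product of the `θ(j)` trivial in `K / H`
    choose k hk using fun o => hsurj (z o)
    refine isConjIn_of_colorIso hf hP hP' hτ
      (θ := fun j => ξ' j * k (c (τ⁻¹ j)) * (ξ (τ⁻¹ j))⁻¹) ?_ ?_
    · simp only [map_mul, map_inv, Finset.prod_mul_distrib, Finset.prod_inv_distrib, hk]
      rw [Equiv.prod_comp τ⁻¹ (fun i => f (ξ i)), Equiv.prod_comp τ⁻¹ (fun i => z (c i)), hz, hy]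
      simp
    · intro i j hij _
      simp [mul_assoc, hij]

/-- The product invariant of `P_λ^α` is the class of `α`. -/
theorem prod_first_eq (hn : 1 ≤ n) (α : K) :
    ∏ j : Fin n, f (if (j : ℕ) = 0 then α else 1) = f α := by
  rw [Finset.prod_eq_single ⟨0, hn⟩]
  · simp
  · intro j _ hj
    rw [if_neg fun h => hj (Fin.ext h), map_one]
  · simp

/-- The classification for an arbitrary way of representing, for each partition `λ` of `n`, the
classes of `K / H` modulo the `gcd(λ)`-th powers. -/
theorem isParabolicRepresentatives_of_existsUnique (hn : 1 ≤ n) [Finite K] (hH : H ≠ ⊥)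
    (hf : f.ker = H) (hsurj : Function.Surjective f) {κ : Type} {L : κ → n.Partition} {a : κ → K}
    (hκ : ∀ (lam : n.Partition) (x : A),
      ∃! k, L k = lam ∧ ∃ y, x = f (a k) * y ^ lam.parts.gcd) :
    IsParabolicRepresentatives (reflGroup n K H hKH)
      (Sum.elim (fun p : (Σ m : Fin n, (m : ℕ).Partition) => partitionGroup n K H hKH p.2 1)
        (fun k => partitionGroup n K H hKH (L k) (a k))) := by
  have hsmall : ∀ (p : Σ m : Fin n, (m : ℕ).Partition), shape (partitionColor n p.2) = p.2.parts :=
    fun p => shape_partitionColor p.1.2.le p.2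
  have hfull : ∀ lam : n.Partition, shape (partitionColor n lam) = lam.parts :=
    fun lam => shape_partitionColor le_rfl lam
  refine ⟨?_, fun P hP => ?_⟩
  · rintro (p | k)
    · exact isParabolic_of_eq_colorStab (coe_partitionGroup p.2 1)
    · exact isParabolic_of_eq_colorStab (coe_partitionGroup (L k) (a k))
  obtain ⟨c, ξ, hc⟩ := hP.exists_colorStab
  have hsum := sum_shape_add_card_none (c := c)
  rw [Fintype.card_fin] at hsum
  by_cases h0 : ∃ i, c i = none
  · obtain ⟨i, hi⟩ := h0
    have hpos : 0 < Finset.card {i | c i = none} := Finset.card_pos.2 ⟨i, by simpa using hi⟩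
    have hlt : (shape c).sum < n := by omega
    let p : Σ m : Fin n, (m : ℕ).Partition :=
      ⟨⟨(shape c).sum, hlt⟩, ⟨shape c, pos_of_mem_shape, rfl⟩⟩
    have hp0 : partitionColor n p.2 ⟨n - 1, by omega⟩ = none := by
      rw [partitionColor_eq_none_iff]
      change (shape c).sum ≤ n - 1
      omega
    refine ⟨Sum.inl p, isConjIn_of_shape_eq hf (coe_partitionGroup p.2 1) hc (hsmall p) hp0, ?_⟩
    rintro (q | k) hq
    · have h1 := IsConjIn.shape_eq hH hf (coe_partitionGroup q.2 1) hc hq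
      rw [hsmall] at h1
      obtain ⟨⟨m, hm⟩, ⟨parts, h2, h3⟩⟩ := q
      simp only at h1 h3
      subst h1
      subst h3
      rfl
    · have h1 := IsConjIn.shape_eq hH hf (coe_partitionGroup (L k) (a k)) hc hq
      rw [hfull] at h1
      have h2 := (L k).parts_sum
      rw [h1] at h2
      omega
  · have h0' : ∀ i, c i ≠ none := fun i hi => h0 ⟨i, hi⟩
    have hcard : Finset.card {i | c i = none} = 0 := by simp [h0']
    let lam : n.Partition := ⟨shape c, pos_of_mem_shape, by omega⟩
    have hiff : ∀ k, IsConjIn (reflGroup n K H hKH) (partitionGroup n K H hKH (L k) (a k)) P ↔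
        L k = lam ∧ ∃ y, ∏ i, f (ξ i) = f (a k) * y ^ lam.parts.gcd := by
      intro k
      rw [isConjIn_iff hH hf hsurj (coe_partitionGroup (L k) (a k)) hc, hfull]
      · simp only [prod_first_eq hn]
        have : L k = lam ↔ (L k).parts = shape c := Nat.Partition.ext_iff
        rw [this]
        refine and_congr_right fun h => ?_
        rw [h]
      · intro i
        rw [Ne, partitionColor_eq_none_iff]
        exact not_le.2 i.2
    obtain ⟨k, hk, hk'⟩ := hκ lam (∏ i, f (ξ i))
    refine ⟨Sum.inr k, (hiff k).2 hk, ?_⟩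
    rintro (q | k') hq
    · have h1 := IsConjIn.shape_eq hH hf (coe_partitionGroup q.2 1) hc hq
      rw [hsmall] at h1
      have h2 := q.2.parts_sum
      rw [h1] at h2
      have := q.1.2
      omega
    · rw [hk' k' ((hiff k').1 hq)]

end

/-! ### The quotient group modulo powers -/

/-- In a finite cyclic group of order `N`, the classes modulo `g`-th powers are represented by
the powers of a generator with exponents below `gcd(N, g)`. -/
theorem existsUnique_pow_mul_pow {A : Type*} [CommGroup A] [Finite A] {a : A}
    (ha : ∀ x, x ∈ Subgroup.zpowers a) (g : ℕ) (x : A) :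
    ∃! s : Fin (Nat.gcd (Nat.card A) g), ∃ y, x = a ^ (s : ℕ) * y ^ g := by
  set d := Nat.gcd (Nat.card A) g with hd
  have hd0 : 0 < d := Nat.gcd_pos_of_pos_left _ Nat.card_pos
  have hord : orderOf a = Nat.card A := orderOf_eq_card_of_forall_mem_zpowers ha
  obtain ⟨t, rfl⟩ := ha x
  -- a power of the generator is a `g`-th power if and only if `d` divides its exponent
  have key : ∀ s : ℕ, (∃ y, a ^ t = a ^ s * y ^ g) ↔ t % (d : ℤ) = s % (d : ℤ) := by
    intro s
    rw [Int.emod_eq_emod_iff_emod_sub_eq_zero, ← Int.dvd_iff_emod_eq_zero]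
    constructor
    · rintro ⟨y, hy⟩
      obtain ⟨w, rfl⟩ := ha y
      have h1 : a ^ (t - s - w * g) = 1 := by
        simp only at hy
        rw [zpow_sub, zpow_sub, hy, zpow_mul, zpow_natCast, zpow_natCast]
        simp
      have h2 := orderOf_dvd_iff_zpow_eq_one.2 h1
      rw [hord] at h2
      have h3 : (d : ℤ) ∣ t - s - w * g :=
        (Int.natCast_dvd_natCast.2 (Nat.gcd_dvd_left _ _)).trans h2
      have h4 : (d : ℤ) ∣ w * g :=
        Dvd.dvd.mul_left (Int.natCast_dvd_natCast.2 (Nat.gcd_dvd_right _ _)) w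
      simpa using dvd_add h3 h4
    · rintro ⟨u, hu⟩
      refine ⟨a ^ (Nat.gcdB (Nat.card A) g * u), ?_⟩
      have ht : t = s + Nat.card A * (Nat.gcdA (Nat.card A) g * u) +
          Nat.gcdB (Nat.card A) g * u * g := by
        have hb := Nat.gcd_eq_gcd_ab (Nat.card A) g
        rw [← hd] at hb
        rw [hb] at hu
        linear_combination hu
      conv_lhs => rw [ht]
      rw [zpow_add, zpow_add, zpow_mul, zpow_natCast, zpow_natCast, pow_card_eq_one', one_zpow,
        mul_one, zpow_mul _ _ (g : ℤ), zpow_natCast]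
  simp only [key]
  have hd0' : (0 : ℤ) < d := by exact_mod_cast hd0
  have hnn := Int.emod_nonneg t hd0'.ne'
  have hlt := Int.emod_lt_of_pos t hd0'
  refine ⟨⟨(t % (d : ℤ)).toNat, by omega⟩, ?_, fun s hs => ?_⟩
  · simp [Int.toNat_of_nonneg hnn]
  · have hs' : (s : ℤ) % (d : ℤ) = s :=
      Int.emod_eq_of_lt (by positivity) (by exact_mod_cast s.2)
    simp only [hs'] at hs
    ext
    simp [hs]

/-! ### Squares in binary dihedral groups -/

open scoped commutatorElement in
/-- In the binary dihedral group of order `8 d`, every square is a commutator. -/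
theorem exists_sq_eq_commutator {d : ℕ} (x : QuaternionGroup (2 * d)) :
    ∃ p q : QuaternionGroup (2 * d), x ^ 2 = ⁅p, q⁆ := by
  have key : ∀ k : ZMod (2 * (2 * d)),
      ⁅(QuaternionGroup.xa 0 : QuaternionGroup (2 * d)), QuaternionGroup.a (-k)⁆ =
        QuaternionGroup.a (k + k) := by
    intro k
    rw [commutatorElement_def, mul_inv_eq_iff_eq_mul, mul_inv_eq_iff_eq_mul]
    simp
  rcases x with i | i
  · exact ⟨QuaternionGroup.xa 0, QuaternionGroup.a (-i), by
      rw [key, sq, QuaternionGroup.a_mul_a]⟩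
  · refine ⟨QuaternionGroup.xa 0, QuaternionGroup.a (-(d : ZMod (2 * (2 * d)))), ?_⟩
    rw [key, QuaternionGroup.xa_sq]
    congr 1
    push_cast
    ring

open scoped commutatorElement in
theorem sq_mem_of_mulEquiv_quaternionGroup {G : Type*} [Group G] {H : Subgroup G}
    (hH : commutator G ≤ H) {d : ℕ} (e : G ≃* QuaternionGroup (2 * d)) (x : G) : x ^ 2 ∈ H := by
  obtain ⟨p, q, h⟩ := exists_sq_eq_commutator (e x)
  have h2 : x ^ 2 = ⁅e.symm p, e.symm q⁆ := by
    rw [← map_commutatorElement, ← h, ← map_pow, e.symm_apply_apply]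
  rw [h2]
  exact hH (Subgroup.commutator_mem_commutator (Subgroup.mem_top _) (Subgroup.mem_top _))

end QuatRefl

theorem mainTheorem9 (n : ℕ) (hn : 1 ≤ n) (K : Subgroup ℍ[ℝ]ˣ) [Finite K]
    (H : Subgroup K) [H.Normal] (hKH : commutator K ≤ H) (hH : H ≠ ⊥) :
    -- (a) the quotient `K / H` is cyclic, generated by the class of `α`
    (∀ α : K, (∀ x : K ⧸ H, x ∈ Subgroup.zpowers (QuotientGroup.mk α : K ⧸ H)) →
      QuatRefl.IsParabolicRepresentatives (QuatRefl.reflGroup n K H hKH)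
        (Sum.elim
          (fun p : (Σ m : Fin n, (m : ℕ).Partition) =>
            QuatRefl.partitionGroup n K H hKH p.2 1)
          (fun p : (Σ lam : n.Partition, Fin (Nat.gcd H.index lam.parts.gcd)) =>
            QuatRefl.partitionGroup n K H hKH p.1 (α ^ (p.2 : ℕ))))) ∧
    -- (b) `K` is binary dihedral of order `8 d` and `H` is cyclic of order `2 d`
    (∀ d : ℕ, 1 ≤ d → Nonempty (K ≃* QuaternionGroup (2 * d)) → IsCyclic H →
      Nat.card H = 2 * d →
      ∀ α β γ : K,
        Function.Bijective (fun i : Fin 4 => (QuotientGroup.mk (![1, α, β, γ] i) : K ⧸ H)) →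
        QuatRefl.IsParabolicRepresentatives (QuatRefl.reflGroup n K H hKH)
          (Sum.elim
            (fun p : (Σ m : Fin n, (m : ℕ).Partition) =>
              QuatRefl.partitionGroup n K H hKH p.2 1)
            (Sum.elim
              (fun lam : {lam : n.Partition // ¬ 2 ∣ lam.parts.gcd} =>
                QuatRefl.partitionGroup n K H hKH lam.1 1)
              (fun p : {lam : n.Partition // 2 ∣ lam.parts.gcd} × Fin 4 =>
                QuatRefl.partitionGroup n K H hKH p.1.1 (![1, α, β, γ] p.2))))) := by
  let _ : CommGroup (K ⧸ H) :=
    { (inferInstance : Group (K ⧸ H)) with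
      mul_comm := (Subgroup.Normal.quotient_commutative_iff_commutator_le.2 hKH).is_comm.comm }
  have hf : (QuotientGroup.mk' H).ker = H := QuotientGroup.ker_mk' H
  have hsurj := QuotientGroup.mk'_surjective H
  refine ⟨fun α hα => ?_, fun d _ he _ _ α β γ hbij => ?_⟩
  · refine QuatRefl.isParabolicRepresentatives_of_existsUnique hn hH hf hsurj
      (L := fun p : (Σ lam : n.Partition, Fin (Nat.gcd H.index lam.parts.gcd)) => p.1)
      (a := fun p => α ^ (p.2 : ℕ)) fun lam x => ?_
    obtain ⟨s, hs, hs'⟩ := QuatRefl.existsUnique_pow_mul_pow hα lam.parts.gcd x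
    refine ⟨⟨lam, s⟩, ⟨rfl, hs⟩, ?_⟩
    rintro ⟨_, s'⟩ ⟨rfl, h⟩
    rw [hs' s' h]
  · have hsq : ∀ x : K ⧸ H, x ^ 2 = 1 := by
      intro x
      obtain ⟨k, rfl⟩ := hsurj x
      rw [← map_pow]
      exact (QuotientGroup.eq_one_iff _).2
        (QuatRefl.sq_mem_of_mulEquiv_quaternionGroup hKH he.some k)
    have h := QuatRefl.isParabolicRepresentatives_of_existsUnique (hKH := hKH) hn hH hf hsurj
      (κ := {lam : n.Partition // ¬ 2 ∣ lam.parts.gcd} ⊕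
        {lam : n.Partition // 2 ∣ lam.parts.gcd} × Fin 4)
      (L := Sum.elim (fun lam => lam.1) (fun p => p.1.1))
      (a := Sum.elim (fun _ => 1) (fun p => ![1, α, β, γ] p.2)) fun lam x => ?_
    · convert h using 2
      funext k
      rcases k with _ | _ <;> rfl
    · by_cases hg : 2 ∣ lam.parts.gcd
      · have hpow : ∀ y : K ⧸ H, y ^ lam.parts.gcd = 1 := by
          intro y
          obtain ⟨u, hu⟩ := hg
          rw [hu, pow_mul, hsq, one_pow]
        obtain ⟨i, hi⟩ := hbij.2 x
        refine ⟨Sum.inr (⟨lam, hg⟩, i), ⟨rfl, 1, ?_⟩, ?_⟩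
        · rw [one_pow, mul_one]
          exact hi.symm
        · rintro (⟨lam', hg'⟩ | ⟨⟨lam', hg'⟩, i'⟩) ⟨h1, y, h2⟩
          · cases h1
            exact absurd hg hg'
          · cases h1
            rw [hpow, mul_one] at h2
            obtain rfl : i = i' := hbij.1 (hi.trans h2)
            rfl
      · refine ⟨Sum.inl ⟨lam, hg⟩, ⟨rfl, x, ?_⟩, ?_⟩
        · obtain ⟨u, hu⟩ := Nat.not_even_iff_odd.1 (fun h => hg h.two_dvd)
          rw [hu, pow_succ, pow_mul, hsq, one_pow, one_mul]
          simp
        · rintro (⟨lam', hg'⟩ | ⟨⟨lam', hg'⟩, i'⟩) ⟨h1, -⟩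
          · cases h1
            rfl
          · cases h1
            exact absurd hg' hg
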